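/- For $z=(z_1,\dots,z_n)\in\mathbb{C}^n$ let $$\delta^{(n)}_{\mathbb{C}}(z)=\frac{1}{(2\pi i)^n}\,\frac{1}{z_1z_2\cdots z_n}.$$ For an invertible complex $4\times4$ matrix $A$, the function $\bar Z\mapsto\delta^{(4)}_{\mathbb{C}}(A\bar Z)$ is holomorphic and homogeneous of degree $-4$ where all four coordinates of $A\bar Z$ are nonzero. Hence it is a Čech 3-cocycle (extended to an alternating function of the indices) for the open cover of $\mathbb{CP}^3$ by the four sets $\{(A\bar Z)_\alpha\neq0\}$, and represents a class in the Čech cohomology $\check H^3(\mathbb{CP}^3,\mathcal{O}(-4))$ (the direct limit over open covers). **Theorem.** Let $h$ be a Hermitian form of signature $(2,2)$ on $\mathbb{C}^4$, and let $\Lambda\in SU(2,2)$, that is, $\Lambda^\dagger h\Lambda=h$ and $\det\Lambda=1$. Then $$\delta^{(4)}_{\mathbb{C}}(\Lambda\bar Z)=\delta^{(4)}_{\mathbb{C}}(\bar Z)$$ in both of the following senses. 1. The two sides represent the same class in $\check H^{3}(\mathbb{CP}^{3},\mathcal{O}(-4))$. 2. The two sides have the same integrals against holomorphic functions. For all $r,s\in(0,\infty)^4$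 and every function $f$ that is holomorphic on an open set $U\subseteq\mathbb{C}^4$ containing the polydiscs $\{|\bar Z_\alpha|\le r_\alpha \text{ for all }\alpha\}$ and $\{|(\Lambda\bar Z)_\alpha|\le s_\alpha\text{ for all }\alpha\}$, $$\int_{\Gamma_\Lambda}\delta^{(4)}_{\mathbb{C}}(\Lambda\bar Z)\,f(\bar Z)\,d\bar Z_0\wedge\cdots\wedge d\bar Z_3=\int_{\Gamma}\delta^{(4)}_{\mathbb{C}}(\bar Z)\,f(\bar Z)\,d\bar Z_0\wedge\cdots\wedge d\bar Z_3 .$$ Here $\Gamma=\{|\bar Z_\alpha|=r_\alpha\}$ and $\Gamma_\Lambda=\{|(\Lambda\bar Z)_\alpha|=s_\alpha\}$ are the tori around the singularities of the respective integrands, parametrized and oriented by the arguments of $\bar Z_0,\dots,\bar Z_3$ and of the coordinates of $\Lambda\bar Z$, respectively. -/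

import Mathlib

open scoped LinearAlgebra.Projectivization Matrix

noncomputable section

namespace TwistorDelta

/-! ### The delta function on `ℂⁿ` -/

/-- The delta function `δ(z) = (2πi)⁻ⁿ · 1 / (z₁ z₂ ⋯ zₙ)` on `ℂⁿ`. -/
def delta {n : ℕ} (z : Fin n → ℂ) : ℂ :=
  1 / (2 * Real.pi * Complex.I) ^ n * (1 / ∏ i, z i)

/-! ### The group `SU(2,2)` -/

/-- A Hermitian form of signature `(2,2)` on `ℂ⁴`, given by its matrix: in a suitable basis it is
`diag(1,1,-1,-1)`. -/
def IsSignature22 (h : Matrix (Fin 4) (Fin 4) ℂ) : Prop :=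
  h.IsHermitian ∧
    ∃ P : Matrix (Fin 4) (Fin 4) ℂ, IsUnit P.det ∧
      Pᴴ * h * P = Matrix.diagonal ![1, 1, -1, -1]

theorem preserves_of_mul_eq_one {A B h : Matrix (Fin 4) (Fin 4) ℂ} (e : A * B = 1)
    (hA : Aᴴ * h * A = h) : Bᴴ * h * B = h := by
  have e' : Bᴴ * Aᴴ = 1 := by rw [← Matrix.conjTranspose_mul, e, Matrix.conjTranspose_one]
  calc Bᴴ * h * B = Bᴴ * (Aᴴ * h * A) * B := by rw [hA]
    _ = (Bᴴ * Aᴴ) * h * (A * B) := by simp only [Matrix.mul_assoc]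
    _ = h := by rw [e, e']; simp

/-- The group of complex `4 × 4` matrices of determinant one which preserve the form `h`. It is
`SU(2,2)` when `h` is Hermitian of signature `(2,2)`. -/
def SU22 (h : Matrix (Fin 4) (Fin 4) ℂ) : Subgroup (GL (Fin 4) ℂ) where
  carrier := {Λ | (Λ : Matrix (Fin 4) (Fin 4) ℂ)ᴴ * h * Λ = h ∧
    (Λ : Matrix (Fin 4) (Fin 4) ℂ).det = 1}
  one_mem' := by simp
  mul_mem' := by
    rintro A B ⟨hA, hA1⟩ ⟨hB, hB1⟩
    refine ⟨?_, by simp [Matrix.det_mul, hA1, hB1]⟩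
    simp only [Units.val_mul, Matrix.conjTranspose_mul]
    calc _ = (B : Matrix (Fin 4) (Fin 4) ℂ)ᴴ * ((A : Matrix (Fin 4) (Fin 4) ℂ)ᴴ * h * A) * B := by
            simp only [Matrix.mul_assoc]
      _ = h := by rw [hA, hB]
  inv_mem' := by
    rintro A ⟨hA, hA1⟩
    have e1 : (A : Matrix (Fin 4) (Fin 4) ℂ) * ((A⁻¹ : GL (Fin 4) ℂ) : Matrix _ _ ℂ) = 1 := by
      rw [← Units.val_mul]; simp
    refine ⟨preserves_of_mul_eq_one e1 hA, ?_⟩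
    have := congrArg Matrix.det e1
    rw [Matrix.det_mul, hA1] at this
    simpa using this

/-! ### Open covers of projective space and the sheaves `𝒪(k)` -/

/-- Projective space `ℂℙⁿ⁻¹` with homogeneous coordinates `(z₁, …, zₙ)`. -/
abbrev CP (n : ℕ) : Type := ℙ ℂ (Fin n → ℂ)

/-- The preimage in `ℂⁿ ∖ {0}` of a subset of projective space. -/
def cone {n : ℕ} (U : Set (CP n)) : Set (Fin n → ℂ) :=
  {z | ∃ hz : z ≠ 0, Projectivization.mk ℂ z hz ∈ U}

/-- An open cover of projective space. A set is open in the quotient topology if and only if its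
preimage in `ℂⁿ ∖ {0}` is open. -/
structure OpenCover (n : ℕ) where
  ι : Type
  U : ι → Set (CP n)
  isOpen_cone : ∀ i, IsOpen (cone (U i))
  covers : ∀ x, ∃ i, x ∈ U i

/-- `f` is a section of `𝒪(k)` over `U`: a holomorphic function on the preimage of `U` in
`ℂⁿ ∖ {0}`, homogeneous of degree `k`. The values of `f` outside this preimage are irrelevant:
two sections over `U` are equal if they agree on `cone U`. -/
def IsSection {n : ℕ} (k : ℤ) (U : Set (CP n)) (f : (Fin n → ℂ) → ℂ) : Prop :=
  DifferentiableOn ℂ f (cone U) ∧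
    ∀ z ∈ cone U, ∀ a : ℂ, a ≠ 0 → f (a • z) = a ^ k * f z

/-! ### Čech cohomology -/

/-- The intersection of the members of a cover with the indices `s 0, …, s p`. -/
def OpenCover.inter {n : ℕ} (𝒰 : OpenCover n) {p : ℕ} (s : Fin (p + 1) → 𝒰.ι) : Set (CP n) :=
  ⋂ a, 𝒰.U (s a)

/-- `c` is a Čech `p`-cochain of the cover `𝒰` with coefficients in `𝒪(k)`. -/
def IsCochain {n : ℕ} (k : ℤ) (𝒰 : OpenCover n) {p : ℕ}
    (c : (Fin (p + 1) → 𝒰.ι) → (Fin n → ℂ) → ℂ) : Prop :=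
  ∀ s, IsSection k (𝒰.inter s) (c s)

/-- The Čech coboundary `(dc)(t₀, …, tₚ₊₁) = ∑ⱼ (-1)ʲ c(t₀, …, t̂ⱼ, …, tₚ₊₁)`. -/
def coboundary {n : ℕ} {ι : Type} {p : ℕ} (c : (Fin (p + 1) → ι) → (Fin n → ℂ) → ℂ) :
    (Fin (p + 2) → ι) → (Fin n → ℂ) → ℂ :=
  fun t z => ∑ j : Fin (p + 2), (-1) ^ (j : ℕ) * c (t ∘ j.succAbove) z

/-- A Čech `p`-cocycle of the cover `𝒰` with coefficients in `𝒪(k)`. -/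
structure Cocycle {n : ℕ} (k : ℤ) (p : ℕ) (𝒰 : OpenCover n) where
  toFun : (Fin (p + 1) → 𝒰.ι) → (Fin n → ℂ) → ℂ
  isCochain : IsCochain k 𝒰 toFun
  isCocycle : ∀ t, ∀ z ∈ cone (𝒰.inter t), coboundary toFun t z = 0

/-- `c` is the coboundary of a cochain of degree `p - 1` with coefficients in `𝒪(k)`; in degree
zero this means that `c = 0`. -/
def IsCoboundary {n : ℕ} (k : ℤ) (𝒰 : OpenCover n) :
    {p : ℕ} → ((Fin (p + 1) → 𝒰.ι) → (Fin n → ℂ) → ℂ) → Prop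
  | 0, c => ∀ s, ∀ z ∈ cone (𝒰.inter s), c s z = 0
  | _ + 1, c => ∃ b, IsCochain k 𝒰 b ∧
      ∀ s, ∀ z ∈ cone (𝒰.inter s), c s z = coboundary b s z

/-- A refinement map from the cover `𝒲` to the cover `𝒰`: every `W i` lies in `U (ρ i)`. -/
def IsRefinement {n : ℕ} (𝒲 𝒰 : OpenCover n) (ρ : 𝒲.ι → 𝒰.ι) : Prop :=
  ∀ i, 𝒲.U i ⊆ 𝒰.U (ρ i)

/-- Cocycles of two covers are cohomologous if their restrictions to some common refinement of the
two covers differ by a coboundary. -/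
def Cohomologous {n : ℕ} (k : ℤ) (p : ℕ) (x y : Σ 𝒰 : OpenCover n, Cocycle k p 𝒰) : Prop :=
  ∃ (𝒲 : OpenCover n) (ρ : 𝒲.ι → x.1.ι) (σ : 𝒲.ι → y.1.ι),
    IsRefinement 𝒲 x.1 ρ ∧ IsRefinement 𝒲 y.1 σ ∧
      IsCoboundary k 𝒲 (fun s z => x.2.toFun (ρ ∘ s) z - y.2.toFun (σ ∘ s) z)

/-- The Čech cohomology `Ȟᵖ(ℂℙⁿ⁻¹, 𝒪(k))`: the direct limit over all open covers, under
refinement, of cocycles modulo coboundaries. -/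
def CechCohomology (n : ℕ) (k : ℤ) (p : ℕ) : Type 1 :=
  Quot (Cohomologous (n := n) k p)

/-- The cohomology class of a cocycle. -/
def Cocycle.cohomologyClass {n : ℕ} {k : ℤ} {p : ℕ} {𝒰 : OpenCover n} (c : Cocycle k p 𝒰) :
    CechCohomology n k p :=
  Quot.mk _ ⟨𝒰, c⟩

/-! ### The delta function as a Čech cocycle -/

/-- The sign of a tuple of indices: the sign of the permutation if it is one, zero otherwise. -/
def tupleSign {n : ℕ} (s : Fin n → Fin n) : ℤ :=
  if h : Function.Bijective s then (Equiv.Perm.sign (Equiv.ofBijective s h) : ℤ) else 0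

theorem tupleSign_eq_det {n : ℕ} (s : Fin n → Fin n) :
    tupleSign s = (Matrix.of fun a b => if s a = b then (1 : ℤ) else 0).det := by
  unfold tupleSign
  split_ifs with h
  · have := Matrix.det_permutation (R := ℤ) (Equiv.ofBijective s h)
    simp only [Int.cast_id] at this
    rw [← this]
    congr 1
    ext a b
    simp [Equiv.Perm.permMatrix, PEquiv.toMatrix_apply, eq_comm]
  · have hs : ¬ Function.Injective s := fun hi => h (Finite.injective_iff_bijective.1 hi)
    simp only [Function.Injective, not_forall] at hs
    obtain ⟨a, b, hab, hne⟩ := hs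
    rw [Matrix.det_zero_of_row_eq hne]
    ext j
    simp [hab]

theorem sum_tupleSign {n : ℕ} (t : Fin (n + 1) → Fin n) :
    ∑ j : Fin (n + 1), (-1 : ℤ) ^ (j : ℕ) * tupleSign (t ∘ j.succAbove) = 0 := by
  let M : Matrix (Fin (n + 1)) (Fin (n + 1)) ℤ :=
    Matrix.of fun a => Fin.cons 1 fun b => if t a = b then 1 else 0
  have hdet : M.det = 0 := by
    refine Matrix.exists_mulVec_eq_zero_iff.1 ⟨Fin.cons 1 fun _ => -1, ?_, ?_⟩
    · intro h
      simpa using congrFun h 0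
    · ext a
      simp [M, Matrix.mulVec, dotProduct, Fin.sum_univ_succ]
  rw [Matrix.det_succ_column_zero] at hdet
  rw [← hdet]
  refine Finset.sum_congr rfl fun j _ => ?_
  rw [tupleSign_eq_det]
  simp only [M, Matrix.of_apply, Fin.cons_zero, mul_one]
  congr 2

/-- The cover of `ℂℙⁿ⁻¹` by the sets `{(A z)ᵢ ≠ 0}`, `i = 1, …, n`. For `A = 1` this is the
standard cover by the sets `{zᵢ ≠ 0}`. -/
def linearCover {n : ℕ} (A : GL (Fin n) ℂ) : OpenCover n where
  ι := Fin n
  U i := {x | ((A : Matrix (Fin n) (Fin n) ℂ) *ᵥ x.rep) i ≠ 0}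
  isOpen_cone i := by
    have : cone {x : CP n | ((A : Matrix (Fin n) (Fin n) ℂ) *ᵥ x.rep) i ≠ 0} =
        {z | ((A : Matrix (Fin n) (Fin n) ℂ) *ᵥ z) i ≠ 0} := by
      ext z
      constructor
      · rintro ⟨hz, h⟩
        obtain ⟨a, ha⟩ := Projectivization.exists_smul_eq_mk_rep ℂ z hz
        simp only [Set.mem_ofPred_eq, ← ha, Units.smul_def, Matrix.mulVec_smul, Pi.smul_apply,
          smul_eq_mul, mul_ne_zero_iff] at h
        exact h.2
      · intro h
        have hz : z ≠ 0 := by rintro rfl; simp at h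
        refine ⟨hz, ?_⟩
        obtain ⟨a, ha⟩ := Projectivization.exists_smul_eq_mk_rep ℂ z hz
        simp only [Set.mem_ofPred_eq, ← ha, Units.smul_def, Matrix.mulVec_smul, Pi.smul_apply,
          smul_eq_mul, mul_ne_zero_iff]
        exact ⟨a.ne_zero, h⟩
    rw [this]
    refine isOpen_ne_fun ?_ continuous_const
    exact (continuous_apply i).comp (Continuous.matrix_mulVec continuous_const continuous_id)
  covers x := by
    by_contra! h
    have h0 : (A : Matrix (Fin n) (Fin n) ℂ) *ᵥ x.rep = 0 := funext fun i => by simpa using h i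
    refine x.rep_nonzero ?_
    have := congrArg (fun v => ((A⁻¹ : GL (Fin n) ℂ) : Matrix (Fin n) (Fin n) ℂ) *ᵥ v) h0
    simpa [Matrix.mulVec_mulVec, ← Units.val_mul] using this

theorem mulVec_ne_zero_of_mem_cone {n : ℕ} (A : GL (Fin n) ℂ) {U : Set (CP n)} {i : Fin n}
    (hU : U ⊆ (linearCover A).U i) {z : Fin n → ℂ} (hz : z ∈ cone U) :
    ((A : Matrix (Fin n) (Fin n) ℂ) *ᵥ z) i ≠ 0 := by
  obtain ⟨hz0, h⟩ := hz
  have h' : ((A : Matrix (Fin n) (Fin n) ℂ) *ᵥ (Projectivization.mk ℂ z hz0).rep) i ≠ 0 := hU h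
  obtain ⟨a, ha⟩ := Projectivization.exists_smul_eq_mk_rep ℂ z hz0
  simp only [← ha, Units.smul_def, Matrix.mulVec_smul, Pi.smul_apply,
    smul_eq_mul, mul_ne_zero_iff] at h'
  exact h'.2

/-- The Čech `p`-cocycle with coefficients in `𝒪(-(p+1))`, for the cover of `ℂℙᵖ` by the `p + 1`
sets `{(A z)ᵢ ≠ 0}`, given by the section `z ↦ δ(A z)` over the intersection of all of these sets
(extended to an alternating function of the indices). -/
def deltaCocycle {p : ℕ} (A : GL (Fin (p + 1)) ℂ) :
    Cocycle (-((p : ℤ) + 1)) p (linearCover A) where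
  toFun s z := tupleSign (n := p + 1) s * delta ((A : Matrix (Fin (p + 1)) (Fin (p + 1)) ℂ) *ᵥ z)
  isCochain := by
    intro s
    change Fin (p + 1) → Fin (p + 1) at s
    by_cases hs : Function.Bijective s
    · have key : ∀ z ∈ cone ((linearCover A).inter s), ∀ i,
          ((A : Matrix (Fin (p + 1)) (Fin (p + 1)) ℂ) *ᵥ z) i ≠ 0 := by
        intro z hz i
        obtain ⟨a, rfl⟩ := hs.2 i
        exact mulVec_ne_zero_of_mem_cone A
          (Set.iInter_subset (fun a => (linearCover A).U (s a)) a) hz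
      have hlin : ∀ i, Differentiable ℂ fun z : Fin (p + 1) → ℂ =>
          ((A : Matrix (Fin (p + 1)) (Fin (p + 1)) ℂ) *ᵥ z) i := by
        intro i
        simp only [Matrix.mulVec, dotProduct]
        fun_prop
      refine ⟨?_, ?_⟩
      · unfold delta
        refine DifferentiableOn.const_mul (DifferentiableOn.const_mul ?_ _) _
        simp only [one_div]
        have hprod : DifferentiableOn ℂ (fun z : Fin (p + 1) → ℂ =>
            ∏ i, ((A : Matrix (Fin (p + 1)) (Fin (p + 1)) ℂ) *ᵥ z) i)
            (cone ((linearCover A).inter s)) :=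
          fun z _ => (HasFDerivAt.finsetProd fun i _ =>
            (hlin i z).hasFDerivAt).differentiableAt.differentiableWithinAt
        exact hprod.fun_inv fun z hz => Finset.prod_ne_zero_iff.2 fun i _ => key z hz i
      · intro z _ a ha
        simp only [delta, Matrix.mulVec_smul, Pi.smul_apply, smul_eq_mul, Finset.prod_mul_distrib,
          Finset.prod_const, Finset.card_univ, Fintype.card_fin]
        rw [zpow_neg, show ((p : ℤ) + 1) = ((p + 1 : ℕ) : ℤ) by push_cast; rfl, zpow_natCast]
        simp only [one_div, mul_inv]
        ring
    · have h0 : tupleSign s = 0 := dif_neg hs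
      refine ⟨?_, ?_⟩ <;> simp only [h0, Int.cast_zero, zero_mul, mul_zero, implies_true]
      exact differentiableOn_const (0 : ℂ)
  isCocycle := by
    intro t z _
    have := congrArg (Int.cast (R := ℂ)) (sum_tupleSign (n := p + 1) t)
    push_cast at this
    simp only [coboundary, ← mul_assoc]
    rw [← Finset.sum_mul]
    erw [this, zero_mul]

/-! ### The delta function as a functional on holomorphic functions -/

/-- The integral of the holomorphic form `g(z) dz₁ ∧ ⋯ ∧ dzₙ` over the `n`-cycle
`θ ↦ γ(θ)`, `θ ∈ [0, 2π]ⁿ`. -/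
def cycleIntegral {n : ℕ} (γ : (Fin n → ℝ) → (Fin n → ℂ)) (g : (Fin n → ℂ) → ℂ) : ℂ :=
  ∫ θ in Set.Icc (0 : Fin n → ℝ) (fun _ => 2 * Real.pi),
    g (γ θ) * (Matrix.of fun i j : Fin n => fderiv ℝ γ θ (Pi.single j 1) i).det

/-- The torus `|(A z)ᵢ| = rᵢ` around the singularities of `z ↦ δ(A z)`, parametrized by the
arguments of the coordinates of `A z`. -/
def torusCycle {n : ℕ} (A : GL (Fin n) ℂ) (r : Fin n → ℝ) : (Fin n → ℝ) → (Fin n → ℂ) :=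
  fun θ => ((A⁻¹ : GL (Fin n) ℂ) : Matrix (Fin n) (Fin n) ℂ) *ᵥ torusMap 0 r θ

/-- The closed polydisc `|(A z)ᵢ| ≤ rᵢ`. -/
def polydisc {n : ℕ} (A : GL (Fin n) ℂ) (r : Fin n → ℝ) : Set (Fin n → ℂ) :=
  {z | ∀ i, ‖((A : Matrix (Fin n) (Fin n) ℂ) *ᵥ z) i‖ ≤ r i}

end TwistorDelta

end

open scoped LinearAlgebra.Projectivization Matrix

noncomputable section

namespace TwistorDelta

/-! ### The cocycle of all linear forms -/

/-! Both senses of the equality depend on `Λ` only through its determinant, which is 1.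

In cohomology, consider the cover by the sets `l ≠ 0` for all linear forms `l`, with the cochain
`det(l₀, …, lₚ) / (l₀ ⋯ lₚ)` up to a constant. Cramer's relation among `p + 2` forms makes it a
cocycle (`linearFormCocycle`). Restricted to the rows of a matrix `A` with `det A = 1`, it is
exactly the alternating cocycle of `δ(A z)`. All such cocycles therefore share one class in the
direct limit, in particular those of `Λ` and of 1.

For the integrals, the substitution `w = A Z` reduces the claim to the iterated Cauchy formula
(`torusIntegral_prod_inv_mul`). The result is `det A⁻¹ * f 0`, whatever the radii. -/

theorem mem_cone_dotProduct {n : ℕ} (l : Fin n → ℂ) (z : Fin n → ℂ) :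
    z ∈ cone {x : CP n | l ⬝ᵥ x.rep ≠ 0} ↔ l ⬝ᵥ z ≠ 0 := by
  have key (hz : z ≠ 0) : l ⬝ᵥ (Projectivization.mk ℂ z hz).rep ≠ 0 ↔ l ⬝ᵥ z ≠ 0 := by
    obtain ⟨a, ha⟩ := Projectivization.exists_smul_eq_mk_rep ℂ z hz
    rw [← ha, Units.smul_def, dotProduct_smul, smul_eq_mul, mul_ne_zero_iff]
    exact and_iff_right a.ne_zero
  constructor
  · rintro ⟨hz, h⟩
    exact (key hz).1 h
  · intro h
    have hz : z ≠ 0 := by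
      rintro rfl
      simp at h
    exact ⟨hz, (key hz).2 h⟩

/-- The cover of `ℂℙⁿ⁻¹` by the sets `{l ≠ 0}`, for all linear forms `l`. -/
def linearFormCover (n : ℕ) : OpenCover n where
  ι := Fin n → ℂ
  U l := {x | l ⬝ᵥ x.rep ≠ 0}
  isOpen_cone l := by
    simp only [Set.ext fun z => mem_cone_dotProduct l z]
    exact isOpen_ne_fun (by unfold dotProduct; fun_prop) continuous_const
  covers x := by
    obtain ⟨i, hi⟩ := Function.ne_iff.1 x.rep_nonzero
    exact ⟨Pi.single i 1, by simpa using hi⟩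

theorem dotProduct_ne_zero_of_mem_cone_inter {n p : ℕ} (s : Fin (p + 1) → Fin n → ℂ)
    {z : Fin n → ℂ} (hz : z ∈ cone ((linearFormCover n).inter s)) (a : Fin (p + 1)) :
    s a ⬝ᵥ z ≠ 0 := by
  obtain ⟨hz0, h⟩ := hz
  exact (mem_cone_dotProduct (s a) z).1 ⟨hz0, Set.mem_iInter.1 h a⟩

/-- Any `n + 1` linear forms on `ℂⁿ` satisfy the linear relation given by Cramer's rule. -/
theorem sum_det_mul_dotProduct {n : ℕ} (t : Fin (n + 1) → Fin n → ℂ) (z : Fin n → ℂ) :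
    ∑ j : Fin (n + 1), (-1 : ℂ) ^ (j : ℕ) * (t j ⬝ᵥ z) *
      (Matrix.of (t ∘ j.succAbove)).det = 0 := by
  let M : Matrix (Fin (n + 1)) (Fin (n + 1)) ℂ :=
    Matrix.of fun a => Fin.cons (t a ⬝ᵥ z) (t a)
  have hdet : M.det = 0 := by
    -- The first column of `M` is the combination of the others with coefficients `z`; the relation
    -- is the Laplace expansion along it.
    refine Matrix.exists_mulVec_eq_zero_iff.1 ⟨Fin.cons 1 (-z), ?_, ?_⟩
    · intro h
      simpa using congrFun h 0
    · ext a
      simp [M, Matrix.mulVec, dotProduct, Fin.sum_univ_succ]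
  rw [Matrix.det_succ_column_zero] at hdet
  rw [← hdet]
  rfl

/-- The Čech cocycle `(l₀, …, lₚ) ↦ (2πi)⁻⁽ᵖ⁺¹⁾ det(l₀, …, lₚ) / (l₀ ⋯ lₚ)` with coefficients in
`𝒪(-(p+1))`, for the cover of `ℂℙᵖ` by the sets `{l ≠ 0}`. -/
def linearFormCocycle (p : ℕ) : Cocycle (-((p : ℤ) + 1)) p (linearFormCover (p + 1)) where
  toFun s z := 1 / (2 * Real.pi * Complex.I) ^ (p + 1) *
    ((Matrix.of s : Matrix (Fin (p + 1)) (Fin (p + 1)) ℂ).det * (∏ a, s a ⬝ᵥ z)⁻¹)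
  isCochain := by
    intro s
    change Fin (p + 1) → Fin (p + 1) → ℂ at s
    refine ⟨?_, ?_⟩
    · refine DifferentiableOn.const_mul (DifferentiableOn.const_mul ?_ _) _
      refine DifferentiableOn.fun_inv ?_ fun z hz => Finset.prod_ne_zero_iff.2 fun a _ =>
        dotProduct_ne_zero_of_mem_cone_inter s hz a
      have hlin : ∀ a, Differentiable ℂ fun z : Fin (p + 1) → ℂ => s a ⬝ᵥ z := by
        intro a
        simp only [dotProduct]
        fun_prop
      exact fun z _ => (HasFDerivAt.finsetProd fun a _ =>
        (hlin a z).hasFDerivAt).differentiableAt.differentiableWithinAt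
    · intro z _ a _
      simp only [dotProduct_smul, smul_eq_mul, Finset.prod_mul_distrib,
        Finset.prod_const, Finset.card_univ, Fintype.card_fin]
      rw [zpow_neg, show ((p : ℤ) + 1) = ((p + 1 : ℕ) : ℤ) by push_cast; rfl, zpow_natCast, mul_inv]
      ring
  isCocycle := by
    intro t z hz
    change Fin (p + 2) → Fin (p + 1) → ℂ at t
    have hne : ∀ j, t j ⬝ᵥ z ≠ 0 := dotProduct_ne_zero_of_mem_cone_inter t hz
    -- Over the common denominator `∏ a, t a ⬝ᵥ z`, the term omitting `t j` gains the numerator `t j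
    -- ⬝ᵥ z`, which gives Cramer's relation.
    rw [← mul_zero (1 / (2 * Real.pi * Complex.I) ^ (p + 1) * (∏ a, t a ⬝ᵥ z)⁻¹),
      ← sum_det_mul_dotProduct t z, Finset.mul_sum]
    refine Finset.sum_congr rfl fun j _ => ?_
    rw [Fin.prod_univ_succAbove _ j, mul_inv]
    have := hne j
    beta_reduce
    field_simp
    rfl

/-- Selecting rows is left multiplication by a 0-1 matrix whose determinant is the sign of the
tuple. -/
theorem det_comp_eq_tupleSign_mul {n : ℕ} (A : Matrix (Fin n) (Fin n) ℂ) (s : Fin n → Fin n) :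
    (Matrix.of fun a => A (s a)).det = tupleSign s * A.det := by
  rw [tupleSign_eq_det, Int.cast_det, ← Matrix.det_mul]
  congr 1
  ext a b
  simp [Matrix.mul_apply]

/-- If `det A = 1`, then the cocycle `δ(A z)` is the restriction of the cocycle of all linear forms
to the rows of `A`. -/
theorem cohomologyClass_deltaCocycle {p : ℕ} (A : GL (Fin (p + 1)) ℂ)
    (hA : (A : Matrix (Fin (p + 1)) (Fin (p + 1)) ℂ).det = 1) :
    (deltaCocycle A).cohomologyClass = (linearFormCocycle p).cohomologyClass := by
  -- The cover of `A` is itself the common refinement: its index `i` goes to the `i`-th row of `A`.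
  refine Quot.sound ⟨linearCover A, id, fun i => (A : Matrix (Fin (p + 1)) (Fin (p + 1)) ℂ) i,
    fun _ => subset_rfl, fun _ => subset_rfl, ?_⟩
  have key : ∀ (s : Fin (p + 1) → Fin (p + 1)), ∀ z ∈ cone ((linearCover A).inter s),
      (deltaCocycle A).toFun (id ∘ s) z - (linearFormCocycle p).toFun
        ((fun i => (A : Matrix (Fin (p + 1)) (Fin (p + 1)) ℂ) i) ∘ s) z = 0 := by
    intro s z _
    have hdet := det_comp_eq_tupleSign_mul (A : Matrix (Fin (p + 1)) (Fin (p + 1)) ℂ) s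
    rw [hA, mul_one] at hdet
    change tupleSign s * delta ((A : Matrix (Fin (p + 1)) (Fin (p + 1)) ℂ) *ᵥ z) -
      1 / (2 * Real.pi * Complex.I) ^ (p + 1) * ((Matrix.of fun a =>
        (A : Matrix (Fin (p + 1)) (Fin (p + 1)) ℂ) (s a)).det *
          (∏ a, (A : Matrix (Fin (p + 1)) (Fin (p + 1)) ℂ) (s a) ⬝ᵥ z)⁻¹) = 0
    rw [hdet]
    by_cases hs : Function.Bijective s
    · rw [hs.prod_comp fun a => (A : Matrix (Fin (p + 1)) (Fin (p + 1)) ℂ) a ⬝ᵥ z]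
      simp only [delta, Matrix.mulVec, one_div]
      ring
    · simp [show tupleSign s = 0 from dif_neg hs]
  -- The restrictions agree exactly, so in positive degree the zero cochain is a primitive.
  cases p with
  | zero => exact key
  | succ p =>
    refine ⟨fun _ _ => 0, fun s => ⟨differentiableOn_const _, by simp⟩, fun s z hz => ?_⟩
    exact (key s z hz).trans (by simp [coboundary])

/-! ### Cauchy's formula on polydiscs -/

/-- Induction on the dimension, with the one-variable Cauchy formula in the first coordinate.
Allowing any open `U` around the polydisc lets the hypotheses pass to slices. -/
theorem torusIntegral_prod_inv_mul {n : ℕ} {R : Fin n → ℝ} (hR : ∀ i, 0 < R i)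
    {U : Set (Fin n → ℂ)} (hU : IsOpen U) {g : (Fin n → ℂ) → ℂ} (hg : DifferentiableOn ℂ g U)
    (hRU : {w : Fin n → ℂ | ∀ i, ‖w i‖ ≤ R i} ⊆ U) :
    (∯ w in T(0, R), (∏ i, w i)⁻¹ * g w) = (2 * Real.pi * Complex.I) ^ n * g 0 := by
  induction n with
  | zero =>
    rw [torusIntegral_dim0]
    simp
  | succ n ih =>
    have hint : TorusIntegrable (fun w => (∏ i, w i)⁻¹ * g w) 0 R := by
      have hmap : Continuous (torusMap 0 R) := by
        unfold torusMap
        fun_prop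
      refine ContinuousOn.integrableOn_compact isCompact_Icc (Continuous.continuousOn ?_)
      refine Continuous.mul (Continuous.inv₀ ?_ fun θ => ?_) ?_
      · exact continuous_finsetProd _ fun i _ => (continuous_apply i).comp hmap
      · refine Finset.prod_ne_zero_iff.2 fun i _ => ?_
        simp [torusMap, (hR i).ne']
      · refine hg.continuousOn.comp_continuous hmap fun θ => hRU fun i => ?_
        simp [torusMap, Complex.norm_exp_ofReal_mul_I, abs_of_pos (hR i)]
    rw [torusIntegral_succ hint]
    have hcons (y : Fin n → ℂ) : Differentiable ℂ fun x : ℂ => (Fin.cons x y : Fin (n + 1) → ℂ) := by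
      refine differentiable_pi.2 fun i => ?_
      refine Fin.cases ?_ (fun j => ?_) i <;> simp
    have hcons' (x : ℂ) :
        Differentiable ℂ fun y : Fin n → ℂ => (Fin.cons x y : Fin (n + 1) → ℂ) := by
      refine differentiable_pi.2 fun i => ?_
      refine Fin.cases ?_ (fun j => ?_) i
      · simp
      · simp only [Fin.cons_succ]
        fun_prop
    -- For `x` on the circle, the induction hypothesis on the slice leaves a Cauchy kernel in `x`,
    -- written with `x - 0` to match the one-variable formula.
    have hinner : Set.EqOn
        (fun x : ℂ => ∯ y in T((0 : Fin (n + 1) → ℂ) ∘ Fin.succ, R ∘ Fin.succ),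
          (∏ i, (Fin.cons x y : Fin (n + 1) → ℂ) i)⁻¹ * g (Fin.cons x y))
        (fun x : ℂ => (x - 0)⁻¹ • ((2 * Real.pi * Complex.I) ^ n * g (Fin.cons x 0)))
        (Metric.sphere 0 (R 0)) := by
      intro x hx
      have hxU : DifferentiableOn ℂ (fun y : Fin n → ℂ => g (Fin.cons x y))
          {y | (Fin.cons x y : Fin (n + 1) → ℂ) ∈ U} :=
        hg.comp (hcons' x).differentiableOn fun y hy => hy
      have := ih (R := R ∘ Fin.succ) (fun i => hR _)
        (hU.preimage (hcons' x).continuous) hxU fun y hy => hRU fun i => by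
          refine Fin.cases ?_ (fun j => ?_) i
          · simpa using (mem_sphere_zero_iff_norm.1 hx).le
          · simpa using hy j
      simp only [Fin.prod_univ_succ, Fin.cons_zero, Fin.cons_succ, mul_inv, mul_assoc] at this ⊢
      rw [sub_zero, smul_eq_mul, ← mul_assoc, mul_assoc, ← this]
      exact torusIntegral_const_mul _ _ _ _
    rw [Pi.zero_apply, circleIntegral.integral_congr (hR 0).le hinner]
    have hd : DifferentiableOn ℂ
        (fun x : ℂ => (2 * Real.pi * Complex.I) ^ n * g (Fin.cons x 0))
        (Metric.closedBall 0 (R 0)) := by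
      refine DifferentiableOn.const_mul (hg.comp (hcons 0).differentiableOn fun x hx => ?_) _
      refine hRU fun i => ?_
      refine Fin.cases ?_ (fun j => ?_) i
      · simpa using hx
      · simpa using (hR _).le
    rw [(hd.diffContOnCl_ball subset_rfl).circleIntegral_sub_inv_smul
      (Metric.mem_ball_self (hR 0))]
    rw [show (Fin.cons 0 0 : Fin (n + 1) → ℂ) = 0 from by
      ext i
      refine Fin.cases ?_ (fun j => ?_) i <;> simp]
    simp only [smul_eq_mul]
    ring

/-- By the chain rule the Jacobian is `A⁻¹` times a diagonal matrix, whose determinant is the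
density built into `torusIntegral`. -/
theorem det_fderiv_torusCycle {n : ℕ} (A : GL (Fin n) ℂ) (r : Fin n → ℝ) (θ : Fin n → ℝ) :
    (Matrix.of fun i j : Fin n => fderiv ℝ (torusCycle A r) θ (Pi.single j 1) i).det =
      ((A⁻¹ : GL (Fin n) ℂ) : Matrix (Fin n) (Fin n) ℂ).det *
        ∏ i, (r i * Complex.exp (θ i * Complex.I) * Complex.I) := by
  rw [← Matrix.det_diagonal, ← Matrix.det_mul]
  congr 1
  ext i j
  set B := ((A⁻¹ : GL (Fin n) ℂ) : Matrix (Fin n) (Fin n) ℂ)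
  have hcoord (k : Fin n) : HasFDerivAt (fun θ : Fin n → ℝ => torusMap 0 r θ k)
      ((ContinuousLinearMap.proj (R := ℝ) (φ := fun _ : Fin n => ℝ) k).smulRight
        (r k * Complex.exp (θ k * Complex.I) * Complex.I)) θ := by
    have h1 : HasDerivAt (fun t : ℝ => (r k : ℂ) * Complex.exp (t * Complex.I))
        (r k * Complex.exp (θ k * Complex.I) * Complex.I) (θ k) := by
      have := (((hasDerivAt_id (θ k)).ofReal_comp.mul_const Complex.I).cexp).const_mul (r k : ℂ)
      simpa [mul_assoc] using this
    have h2 := h1.hasFDerivAt.comp θ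
      (ContinuousLinearMap.proj (R := ℝ) (φ := fun _ : Fin n => ℝ) k).hasFDerivAt
    have h3 : (fun θ : Fin n → ℝ => torusMap 0 r θ k) =
        (fun t : ℝ => (r k : ℂ) * Complex.exp (t * Complex.I)) ∘
          (ContinuousLinearMap.proj (R := ℝ) (φ := fun _ : Fin n => ℝ) k) := by
      ext θ
      simp [torusMap]
    rw [h3]
    exact h2.congr_fderiv (by ext v; simp)
  have hsum : HasFDerivAt (fun θ => torusCycle A r θ)
      (ContinuousLinearMap.pi fun i => ∑ k, B i k •
        (ContinuousLinearMap.proj (R := ℝ) (φ := fun _ : Fin n => ℝ) k).smulRight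
        (r k * Complex.exp (θ k * Complex.I) * Complex.I)) θ :=
    hasFDerivAt_pi.2 fun i => HasFDerivAt.fun_sum (u := Finset.univ) fun k _ =>
      (hcoord k).const_mul (B i k)
  rw [Matrix.of_apply, show fderiv ℝ (torusCycle A r) θ = _ from hsum.fderiv]
  simp [Matrix.mul_diagonal, Pi.single_apply]

/-- The delta function evaluates holomorphic functions at the origin, up to the determinant. -/
theorem cycleIntegral_torusCycle_delta_mul {n : ℕ} (A : GL (Fin n) ℂ) {r : Fin n → ℝ}
    (hr : ∀ i, 0 < r i) {U : Set (Fin n → ℂ)} (hU : IsOpen U) {f : (Fin n → ℂ) → ℂ}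
    (hf : DifferentiableOn ℂ f U) (hrU : polydisc A r ⊆ U) :
    cycleIntegral (torusCycle A r)
        (fun Z => delta ((A : Matrix (Fin n) (Fin n) ℂ) *ᵥ Z) * f Z) =
      ((A⁻¹ : GL (Fin n) ℂ) : Matrix (Fin n) (Fin n) ℂ).det * f 0 := by
  set B := ((A⁻¹ : GL (Fin n) ℂ) : Matrix (Fin n) (Fin n) ℂ) with hB
  have hAB (w : Fin n → ℂ) : (A : Matrix (Fin n) (Fin n) ℂ) *ᵥ (B *ᵥ w) = w := by
    rw [Matrix.mulVec_mulVec, hB, ← Units.val_mul, mul_inv_cancel, Units.val_one, Matrix.one_mulVec]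
  have hBd : Differentiable ℂ fun w : Fin n → ℂ => B *ᵥ w := by
    refine differentiable_pi.2 fun i => ?_
    simp only [Matrix.mulVec, dotProduct]
    fun_prop
  have hpi : (2 * Real.pi * Complex.I : ℂ) ^ n ≠ 0 := pow_ne_zero _ Complex.two_pi_I_ne_zero
  -- In the coordinates `w = A Z` the polydisc is standard and the integrand involves `f ∘ B`, whose
  -- value at 0 is `f 0`.
  have hC := torusIntegral_prod_inv_mul hr (hU.preimage hBd.continuous)
    (hf.comp hBd.differentiableOn fun w hw => hw) fun w hw => hrU fun i => by
      simpa only [hAB] using hw i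
  rw [torusIntegral] at hC
  rw [cycleIntegral]
  simp only [det_fderiv_torusCycle, ← hB]
  have hrw (θ : Fin n → ℝ) :
      delta ((A : Matrix (Fin n) (Fin n) ℂ) *ᵥ torusCycle A r θ) * f (torusCycle A r θ) *
        (B.det * ∏ i, (r i * Complex.exp (θ i * Complex.I) * Complex.I)) =
      (B.det * ((2 * Real.pi * Complex.I : ℂ) ^ n)⁻¹) *
        ((∏ i, (r i * Complex.exp (θ i * Complex.I) * Complex.I)) •
          ((∏ i, torusMap 0 r θ i)⁻¹ * (f ∘ fun w => B *ᵥ w) (torusMap 0 r θ))) := by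
    simp only [torusCycle, ← hB, hAB, delta, one_div, Function.comp_apply, smul_eq_mul]
    ring
  simp only [hrw]
  rw [MeasureTheory.integral_const_mul, hC, mul_assoc, inv_mul_cancel_left₀ hpi]
  simp

end TwistorDelta

end

theorem mainTheorem9 (h : Matrix (Fin 4) (Fin 4) ℂ) (hh : TwistorDelta.IsSignature22 h)
    (Λ : GL (Fin 4) ℂ) (hΛ : Λ ∈ TwistorDelta.SU22 h) :
    -- `δ(Λ Z) = δ(Z)` in the Čech cohomology `H³(ℂℙ³, 𝒪(-4))`
    (TwistorDelta.deltaCocycle (p := 3) Λ).cohomologyClass =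
        (TwistorDelta.deltaCocycle (p := 3) 1).cohomologyClass ∧
      -- `δ(Λ Z) = δ(Z)` when integrated against holomorphic functions
      ∀ (r s : Fin 4 → ℝ), (∀ i, 0 < r i) → (∀ i, 0 < s i) →
        ∀ (U : Set (Fin 4 → ℂ)) (f : (Fin 4 → ℂ) → ℂ), IsOpen U → DifferentiableOn ℂ f U →
          TwistorDelta.polydisc Λ s ⊆ U → TwistorDelta.polydisc 1 r ⊆ U →
          TwistorDelta.cycleIntegral (TwistorDelta.torusCycle Λ s)
              (fun Z => TwistorDelta.delta ((Λ : Matrix (Fin 4) (Fin 4) ℂ) *ᵥ Z) * f Z) =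
            TwistorDelta.cycleIntegral (TwistorDelta.torusCycle 1 r)
              (fun Z => TwistorDelta.delta Z * f Z) := by
  have hdet : (Λ : Matrix (Fin 4) (Fin 4) ℂ).det = 1 := hΛ.2
  refine ⟨?_, fun r s hr hs U f hU hf hsU hrU => ?_⟩
  · rw [TwistorDelta.cohomologyClass_deltaCocycle Λ hdet,
      TwistorDelta.cohomologyClass_deltaCocycle 1 (by simp)]
  · have h1 := TwistorDelta.cycleIntegral_torusCycle_delta_mul 1 hr hU hf hrU
    simp only [Units.val_one, Matrix.one_mulVec, inv_one, Matrix.det_one] at h1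
    rw [h1, TwistorDelta.cycleIntegral_torusCycle_delta_mul Λ hs hU hf hsU]
    congr 1
    -- What remains is `det Λ⁻¹ = 1`, as the group is closed under inverses.
    exact ((TwistorDelta.SU22 h).inv_mem hΛ).2
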